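/- Let $F$ be an algebraically closed field (of arbitrary characteristic). Call $A,B\in M_n(F)$ congruent if $B=X^{T}AX$ for some $X\in \mathrm{GL}_n(F)$, and call bilinear forms $f:V\times V\to F$ and $g:W\times W\to F$ equivalent if there is a linear isomorphism $x:V\to W$ with $g(xu,xv)=f(u,v)$ for all $u,v\in V$. Then: (1) for every $n$, every matrix $A\in M_n(F)$ is congruent to its transpose $A^{T}$; (2) equivalently, for every finite-dimensional vector space $V$ over $F$, every bilinear form $f:V\times V\to F$ (degenerate or not) is equivalent to its transpose $f'$, defined by $f'(u,v)=f(v,u)$. -/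

import Mathlib

/-- Two square matrices `A, B` over a commutative ring are congruent if `B = Xᵀ * A * X`
for some invertible matrix `X`. -/
def Matrix.IsCongruentTo {F : Type*} [CommRing F] {n : ℕ} (A B : Matrix (Fin n) (Fin n) F) :
    Prop :=
  ∃ X : Matrix.GeneralLinearGroup (Fin n) F,
    B = (X : Matrix (Fin n) (Fin n) F).transpose * A * (X : Matrix (Fin n) (Fin n) F)

namespace LinearMap.BilinForm

open LinearMap (BilinForm)
open Module Polynomial

/-! ### Splitting off biorthogonal summands -/

section Field

variable {F V : Type*} [Field F] [AddCommGroup V] [Module F V]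

/-! Isometries between a form and its transpose glue along biorthogonal decompositions. By induction
on dimension (`hI`) it therefore suffices to decompose into proper summands, or to split off one
nonzero summand that visibly has such an isometry (`equivalent_flip_of_family`). Regular case: some
`f - l • f.flip` with `l² ≠ 1` is nondegenerate. An isometry of that form with its transpose also
serves `f`, so `f` may be taken nondegenerate. Then `f x y = f y (σ x)` for an invertible `σ`, and
passing from `σ` to `σ⁻¹` reverses the form along `σ`-orbits. Let `l` be an eigenvalue of `σ`. If
`l² ≠ 1`, a longest Jordan chain for `l` is paired with one for `l⁻¹`; both are isotropic, and the
isometry swaps their generators. If `l² = 1`, Fitting's decomposition reduces to `N = σ - l`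
nilpotent, with `N ^ k` its last nonzero power. Either some `f x (N ^ k x) ≠ 0` and the cyclic space
of `x` splits off, or `f x (N ^ k y)` is alternating and a pair of isotropic generators exists
(`exists_isotropic`); only the latter is delicate in characteristic 2. Singular case: `det (A - X
Aᵀ) = 0` for a Gram matrix `A`. A polynomial kernel vector gives a null chain. A shortest one either
starts in the radical or has a dual chain; the two together span a summand, and reversing both
chains transposes its Gram matrix. -/

theorem equivalent_flip_iff {f : BilinForm F V} :
    f.Equivalent f.flip ↔ ∃ g : V ≃ₗ[F] V, ∀ x y, f (g x) (g y) = f y x :=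
  ⟨fun ⟨g⟩ => ⟨g.toLinearEquiv, fun x y => g.map_app' y x⟩,
    fun ⟨g, hg⟩ => ⟨{ g with map_app' := fun x y => hg y x }⟩⟩

/-- The vectors that are orthogonal to a subspace on both sides. -/
def biorthogonal (f : BilinForm F V) (U : Submodule F V) : Submodule F V where
  carrier := {w | ∀ u ∈ U, f u w = 0 ∧ f w u = 0}
  add_mem' := fun ha hb u hu => by simp [ha u hu, hb u hu]
  zero_mem' := fun u _ => by simp
  smul_mem' := fun c x hx u hu => by simp [hx u hu]

theorem mem_biorthogonal_span {f : BilinForm F V} {s : Set V} {w : V} :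
    w ∈ f.biorthogonal (Submodule.span F s) ↔ ∀ u ∈ s, f u w = 0 ∧ f w u = 0 := by
  refine ⟨fun h u hu => h u (Submodule.subset_span hu), fun h u hu => ?_⟩
  induction hu using Submodule.span_induction with
  | mem x hx => exact h x hx
  | zero => simp
  | add x y _ _ hx hy => simp [hx, hy]
  | smul c x _ hx => simp [hx]

theorem equivalent_flip_of_isCompl {f : BilinForm F V} {U W : Submodule F V} (hUW : IsCompl U W)
    (horth : ∀ u ∈ U, ∀ w ∈ W, f u w = 0 ∧ f w u = 0)
    (hU : (f.restrict U).Equivalent (f.restrict U).flip)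
    (hW : (f.restrict W).Equivalent (f.restrict W).flip) : f.Equivalent f.flip := by
  obtain ⟨g, hg⟩ := equivalent_flip_iff.1 hU
  obtain ⟨h, hh⟩ := equivalent_flip_iff.1 hW
  let e := Submodule.prodEquivOfIsCompl U W hUW
  refine equivalent_flip_iff.2 ⟨(e.symm.trans (g.prodCongr h)).trans e, fun x y => ?_⟩
  obtain ⟨⟨u, w⟩, rfl⟩ := e.surjective x
  obtain ⟨⟨u', w'⟩, rfl⟩ := e.surjective y
  have h1 : f (g u) (g u') = f u' u := hg u u'
  have h2 : f (h w) (h w') = f w' w := hh w w'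
  simp [e, h1, h2, (horth _ u.2 _ w'.2).2, (horth _ u'.2 _ w.2).1, (horth _ (g u).2 _ (h w').2).1,
    (horth _ (g u').2 _ (h w).2).2]

variable [FiniteDimensional F V]

/-- The family `e` may be dependent: choose coefficients by a linear section and apply them to `e'`.
A vector killed by this map is biorthogonal to the span, so the map is injective. -/
theorem restrict_span_equivalent_flip {f : BilinForm F V} {ι : Type*} {e e' : ι → V}
    (he' : ∀ i, e' i ∈ Submodule.span F (Set.range e))
    (hee' : ∀ i j, f (e' i) (e' j) = f (e j) (e i))
    (hdisj : Disjoint (Submodule.span F (Set.range e))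
      (f.biorthogonal (Submodule.span F (Set.range e)))) :
    (f.restrict (Submodule.span F (Set.range e))).Equivalent
      (f.restrict (Submodule.span F (Set.range e))).flip := by
  set U := Submodule.span F (Set.range e) with hU
  have key : ∀ c d, f (Finsupp.linearCombination F e' c) (Finsupp.linearCombination F e' d) =
      f (Finsupp.linearCombination F e d) (Finsupp.linearCombination F e c) := by
    intro c d
    induction c using Finsupp.induction_linear with
    | zero => simp
    | add c₁ c₂ h₁ h₂ => simp [h₁, h₂]
    | single i a =>
      induction d using Finsupp.induction_linear with
      | zero => simp
      | add c₁ c₂ h₁ h₂ => simp only [map_add, h₁, h₂, LinearMap.add_apply]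
      | single j b => simp [hee']; ring
  have hmem : ∀ c, Finsupp.linearCombination F e' c ∈ U := fun c =>
    Submodule.sum_mem _ fun i _ => Submodule.smul_mem _ _ (he' i)
  have hmem' : ∀ c, Finsupp.linearCombination F e c ∈ U := fun c =>
    Submodule.sum_mem _ fun i _ => Submodule.smul_mem _ _ (Submodule.subset_span ⟨i, rfl⟩)
  let Φ : (ι →₀ F) →ₗ[F] U := (Finsupp.linearCombination F e).codRestrict U hmem'
  have hΦ : LinearMap.range Φ = ⊤ := by
    rw [LinearMap.range_eq_top]
    rintro ⟨x, hx⟩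
    obtain ⟨c, hc⟩ := (Finsupp.mem_span_range_iff_exists_finsupp).1 hx
    exact ⟨c, Subtype.ext hc⟩
  obtain ⟨s, hs⟩ := Φ.exists_rightInverse_of_surjective hΦ
  have hs' : ∀ x, Finsupp.linearCombination F e (s x) = x := fun x =>
    congrArg Subtype.val (LinearMap.congr_fun hs x)
  let h : U →ₗ[F] U := ((Finsupp.linearCombination F e').codRestrict U hmem) ∘ₗ s
  have hh : ∀ x y, f (h x) (h y) = f y x := fun x y => by
    have := key (s x) (s y)
    rwa [hs', hs'] at this
  have hinj : Function.Injective h := by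
    rw [← LinearMap.ker_eq_bot, LinearMap.ker_eq_bot']
    intro x hx
    have : (x : V) ∈ f.biorthogonal U := fun u hu => by
      have h1 := hh x ⟨u, hu⟩
      have h2 := hh ⟨u, hu⟩ x
      simp only [hx, ZeroMemClass.coe_zero, map_zero, LinearMap.zero_apply] at h1 h2
      exact ⟨h1.symm, h2.symm⟩
    exact Subtype.ext (Submodule.disjoint_def.1 hdisj x x.2 this)
  exact equivalent_flip_iff.2 ⟨LinearEquiv.ofInjectiveEndo h hinj, fun x y => hh x y⟩

theorem equivalent_flip_of_family {f : BilinForm F V}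
    (hI : ∀ W : Submodule F V, W ≠ ⊤ → ∀ g : BilinForm F W, g.Equivalent g.flip)
    {ι : Type*} {e e' : ι → V} (hne : ∃ i, e i ≠ 0)
    (he' : ∀ i, e' i ∈ Submodule.span F (Set.range e))
    (hee' : ∀ i j, f (e' i) (e' j) = f (e j) (e i))
    (hc : IsCompl (Submodule.span F (Set.range e))
      (f.biorthogonal (Submodule.span F (Set.range e)))) : f.Equivalent f.flip := by
  refine equivalent_flip_of_isCompl hc (fun u hu w hw => hw u hu)
    (restrict_span_equivalent_flip he' hee' hc.disjoint) (hI _ ?_ _)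
  intro htop
  obtain ⟨i, hi⟩ := hne
  refine hi (Submodule.disjoint_def.1 hc.disjoint _ (Submodule.subset_span ⟨i, rfl⟩) ?_)
  rw [htop]; trivial

end Field

/-! ### The asymmetry and its cyclic subspaces -/

section Asymmetry

variable {F V : Type*} [Field F] [AddCommGroup V] [Module F V]

/-- `σ`, with inverse `τ`, is the asymmetry of the bilinear form `f`. -/
structure IsAsymmetry (f : BilinForm F V) (σ τ : End F V) : Prop where
  apply_eq : ∀ x y, f x y = f y (σ x)
  mul_inv : σ * τ = 1
  inv_mul : τ * σ = 1

namespace IsAsymmetry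

variable {f : BilinForm F V} {σ τ : End F V}

theorem apply_inv (h : IsAsymmetry f σ τ) (x : V) : σ (τ x) = x :=
  LinearMap.congr_fun h.mul_inv x

theorem inv_apply (h : IsAsymmetry f σ τ) (x : V) : τ (σ x) = x :=
  LinearMap.congr_fun h.inv_mul x

theorem map_map (h : IsAsymmetry f σ τ) (x y : V) : f (σ x) (σ y) = f x y := by
  rw [h.apply_eq x y, h.apply_eq y (σ x)]

theorem map_left (h : IsAsymmetry f σ τ) (x y : V) : f (σ x) y = f x (τ y) := by
  rw [← h.map_map x (τ y), h.apply_inv]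

theorem pow_map_pow_map (h : IsAsymmetry f σ τ) (n : ℕ) (x y : V) :
    f ((σ ^ n) x) ((σ ^ n) y) = f x y := by
  induction n with
  | zero => simp
  | succ n ih => rw [pow_succ', Module.End.mul_apply, Module.End.mul_apply, h.map_map, ih]

theorem commute (h : IsAsymmetry f σ τ) : Commute σ τ := h.mul_inv.trans h.inv_mul.symm

theorem pow_apply_inv_pow (h : IsAsymmetry f σ τ) (n : ℕ) (x : V) : (σ ^ n) ((τ ^ n) x) = x := by
  rw [← Module.End.mul_apply, ← h.commute.mul_pow, h.mul_inv, one_pow, Module.End.one_apply]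

theorem inv_pow_inv_pow (h : IsAsymmetry f σ τ) (m n : ℕ) (x y : V) :
    f ((τ ^ n) x) ((τ ^ m) y) = f ((σ ^ m) x) ((σ ^ n) y) := by
  rw [← h.pow_map_pow_map (n + m), pow_add, Module.End.mul_apply, Module.End.mul_apply,
    h.pow_apply_inv_pow, ← Module.End.mul_apply (σ ^ n), (Commute.pow_pow_self σ n m).eq,
    Module.End.mul_apply, h.pow_apply_inv_pow]

/-- The left side is the adjoint of `σ - l`, so moving `σ - l` across `f` yields `σ - l⁻¹` up to an
invertible factor. -/
theorem sub_eq (h : IsAsymmetry f σ τ) {l : F} (hl : l ≠ 0) :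
    τ - algebraMap F (End F V) l = (-l • τ) * (σ - algebraMap F (End F V) l⁻¹) := by
  rw [smul_mul_assoc, mul_sub, h.inv_mul, ← Algebra.commutes, ← Algebra.smul_def, smul_sub,
    smul_smul, Algebra.algebraMap_eq_smul_one]
  simp [hl, sub_eq_add_neg, add_comm]

theorem sub_pow_left (h : IsAsymmetry f σ τ) {l : F} (hl : l ≠ 0) (m : ℕ) (x y : V) :
    f (((σ - algebraMap F (End F V) l) ^ m) x) y =
      f x (((-l • τ) ^ m) (((σ - algebraMap F (End F V) l⁻¹) ^ m) y)) := by
  have hc : Commute (-l • τ) (σ - algebraMap F (End F V) l⁻¹) :=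
    (h.commute.symm.sub_right (Algebra.commutes _ _).symm).smul_left _
  rw [← Module.End.mul_apply (_ ^ m), ← hc.mul_pow, ← h.sub_eq hl]
  induction m generalizing x with
  | zero => simp
  | succ m ih =>
    rw [pow_succ, Module.End.mul_apply, ih, pow_succ', Module.End.mul_apply]
    simp [h.map_left]

end IsAsymmetry

/-- In a cyclic module killed by `(X - l) ^ (k + 1)`, every nonzero element has a multiple that is a
nonzero scalar times the last chain vector. Here `c = q(l)`, where `p = (X - l) ^ i * q`. -/
theorem exists_mul_aeval_eq_smul {σ : End F V} {l : F} {k : ℕ} {u : V}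
    (hu : ((σ - algebraMap F (End F V) l) ^ (k + 1)) u = 0) {p : F[X]} (hp : aeval σ p u ≠ 0) :
    ∃ r : F[X], ∃ c : F, c ≠ 0 ∧
      aeval σ (r * p) u = c • ((σ - algebraMap F (End F V) l) ^ k) u := by
  have hp0 : p ≠ 0 := by rintro rfl; simp at hp
  obtain ⟨q, hq, hndvd⟩ := p.exists_eq_pow_rootMultiplicity_mul_and_not_dvd hp0 l
  set i := p.rootMultiplicity l
  have hX : aeval σ (X - C l) = σ - algebraMap F (End F V) l := by simp
  have hi : i ≤ k := by
    by_contra hik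
    apply hp
    obtain ⟨j, hj⟩ := Nat.exists_eq_add_of_lt (not_le.1 hik)
    rw [hq, show i = j + (k + 1) by omega, pow_add, mul_comm, ← mul_assoc, map_mul, map_pow, hX,
      Module.End.mul_apply, hu, map_zero]
  have hq0 : q.eval l ≠ 0 := fun h0 => hndvd (dvd_iff_isRoot.2 h0)
  refine ⟨(X - C l) ^ (k - i), q.eval l, hq0, ?_⟩
  obtain ⟨s, hs⟩ : (X - C l) ∣ q - C (q.eval l) := by
    rw [dvd_iff_isRoot]; simp
  rw [hq, ← mul_assoc, ← pow_add, Nat.sub_add_cancel hi, sub_eq_iff_eq_add.1 hs,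
    show (X - C l) ^ k * ((X - C l) * s + C (q.eval l)) =
      s * (X - C l) ^ (k + 1) + C (q.eval l) * (X - C l) ^ k by ring,
    map_add, map_mul, map_mul, map_pow, map_pow, hX, LinearMap.add_apply, Module.End.mul_apply, hu,
    aeval_C, Module.End.mul_apply]
  simp

theorem exists_sum_aeval_of_mem_span {σ : End F V} {ι : Type*} [Fintype ι] {u : ι → V} {x : V}
    (hx : x ∈ Submodule.span F (Set.range fun j : ι × ℕ => (σ ^ j.2) (u j.1))) :
    ∃ p : ι → F[X], x = ∑ i, aeval σ (p i) (u i) := by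
  classical
  induction hx using Submodule.span_induction with
  | mem x hx =>
    obtain ⟨⟨i, n⟩, rfl⟩ := hx
    refine ⟨Pi.single i (X ^ n), ?_⟩
    rw [Finset.sum_eq_single i]
    · simp
    · intro j _ hj; simp [Pi.single_eq_of_ne hj]
    · simp
  | zero => exact ⟨0, by simp⟩
  | add x y _ _ hx hy =>
    obtain ⟨p, rfl⟩ := hx
    obtain ⟨q, rfl⟩ := hy
    exact ⟨p + q, by simp [Finset.sum_add_distrib]⟩
  | smul c x _ hx =>
    obtain ⟨p, rfl⟩ := hx
    exact ⟨c • p, by simp [Finset.smul_sum]⟩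

variable [FiniteDimensional F V]

/-- For `σ`-stable `U`, vanishing of `f x` on `U` already gives biorthogonality, so `f` restricted
to `U` is nondegenerate and represents every functional on `U`. -/
theorem IsAsymmetry.isCompl_biorthogonal {f : BilinForm F V} {σ τ : End F V}
    (h : IsAsymmetry f σ τ) {U : Submodule F V} (hU : ∀ x ∈ U, σ x ∈ U)
    (hd : Disjoint U (f.biorthogonal U)) : IsCompl U (f.biorthogonal U) := by
  refine ⟨hd, ?_⟩
  have hP : ∀ x, (∀ y ∈ U, f x y = 0) → x ∈ f.biorthogonal U := fun x hx y hy =>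
    ⟨by rw [h.apply_eq]; exact hx _ (hU y hy), hx y hy⟩
  have hinj : Function.Injective (f.restrict U) := by
    rw [← LinearMap.ker_eq_bot, LinearMap.ker_eq_bot']
    intro x hx
    exact Subtype.ext (Submodule.disjoint_def.1 hd x x.2
      (hP x fun y hy => LinearMap.congr_fun hx ⟨y, hy⟩))
  have hsurj := (LinearMap.injective_iff_surjective_of_finrank_eq_finrank
    (Subspace.dual_finrank_eq (K := F) (V := U)).symm).1 hinj
  rw [codisjoint_iff, eq_top_iff]
  intro v _
  obtain ⟨x, hx⟩ := hsurj ((f v).domRestrict U)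
  refine Submodule.mem_sup.2 ⟨x, x.2, v - x, hP _ fun y hy => ?_, by simp⟩
  have : f x y = f v y := LinearMap.congr_fun hx ⟨y, hy⟩
  simp [this]

theorem IsAsymmetry.inv_mem {f : BilinForm F V} {σ τ : End F V}
    (h : IsAsymmetry f σ τ) {U : Submodule F V} (hU : ∀ x ∈ U, σ x ∈ U) {x : V} (hx : x ∈ U) :
    τ x ∈ U := by
  have hinj : Function.Injective (σ.restrict hU) := fun a b hab => by
    have : σ a = σ b := congrArg Subtype.val hab
    rw [← Subtype.coe_inj, ← h.inv_apply (a : V), this, h.inv_apply]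
  obtain ⟨y, hy⟩ := LinearMap.injective_iff_surjective.1 hinj ⟨x, hx⟩
  have : σ y = x := congrArg Subtype.val hy
  rw [← this, h.inv_apply]
  exact y.2

/-- The isometry sends `σ ^ n (u i)` to `τ ^ n (u (π i))`. If a vector of the span is biorthogonal
to it, a multiple of it has `i`-th component proportional to the last vector of chain `i`, and
pairing with `u (π i)` detects that component alone. -/
theorem IsAsymmetry.equivalent_flip_of_generators {f : BilinForm F V} {σ τ : End F V}
    (h : IsAsymmetry f σ τ)
    (hI : ∀ W : Submodule F V, W ≠ ⊤ → ∀ g : BilinForm F W, g.Equivalent g.flip)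
    {ι : Type*} [Fintype ι] [Nonempty ι] {u : ι → V} (π : ι → ι) {l : ι → F} {k : ι → ℕ}
    (hu : ∀ i, ((σ - algebraMap F (End F V) (l i)) ^ (k i + 1)) (u i) = 0)
    (hpair : ∀ i, f (((σ - algebraMap F (End F V) (l i)) ^ k i) (u i)) (u (π i)) ≠ 0)
    (horth : ∀ i j, j ≠ i → ∀ n, f ((σ ^ n) (u j)) (u (π i)) = 0)
    (hsymm : ∀ i j m n, f ((σ ^ m) (u (π i))) ((σ ^ n) (u (π j))) =
      f ((σ ^ m) (u j)) ((σ ^ n) (u i))) : f.Equivalent f.flip := by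
  classical
  let e : ι × ℕ → V := fun j => (σ ^ j.2) (u j.1)
  have hU : ∀ x ∈ Submodule.span F (Set.range e), σ x ∈ Submodule.span F (Set.range e) := by
    intro x hx
    induction hx using Submodule.span_induction with
    | mem x hx =>
      obtain ⟨⟨i, n⟩, rfl⟩ := hx
      refine Submodule.subset_span ⟨(i, n + 1), ?_⟩
      simp [e, pow_succ']
    | zero => simp
    | add x y _ _ hx hy => rw [map_add]; exact add_mem hx hy
    | smul c x _ hx => rw [map_smul]; exact Submodule.smul_mem _ _ hx
  have hue : ∀ i, u i ∈ Submodule.span F (Set.range e) := fun i =>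
    Submodule.subset_span ⟨(i, 0), by simp [e]⟩
  refine equivalent_flip_of_family (e := e) (e' := fun j => (τ ^ j.2) (u (π j.1))) hI ?_ ?_ ?_
    (h.isCompl_biorthogonal hU ?_)
  · obtain ⟨i⟩ := ‹Nonempty ι›
    refine ⟨(i, 0), fun h0 => hpair i ?_⟩
    have : u i = 0 := by simpa [e] using h0
    simp [this]
  · rintro ⟨i, n⟩
    induction n with
    | zero => simpa using hue (π i)
    | succ n ih =>
      rw [pow_succ', Module.End.mul_apply]
      exact h.inv_mem hU ih
  · rintro ⟨i, n⟩ ⟨j, m⟩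
    rw [h.inv_pow_inv_pow, hsymm]
  · rw [Submodule.disjoint_def]
    intro x hx hxP
    obtain ⟨p, rfl⟩ := exists_sum_aeval_of_mem_span hx
    refine Finset.sum_eq_zero fun i _ => ?_
    by_contra hpi
    obtain ⟨r, c, hc, hr⟩ := exists_mul_aeval_eq_smul (hu i) hpi
    have hstab : ∀ (s : F[X]), ∀ y ∈ f.biorthogonal (Submodule.span F (Set.range e)),
        aeval σ s y ∈ f.biorthogonal (Submodule.span F (Set.range e)) := by
      intro s y hy
      induction s using Polynomial.induction_on' with
      | add s t hs ht => rw [map_add]; exact add_mem hs ht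
      | monomial n a =>
        rw [aeval_monomial, ← Algebra.smul_def, LinearMap.smul_apply]
        refine Submodule.smul_mem _ _ ?_
        induction n with
        | zero => simpa using hy
        | succ n ih =>
          rw [pow_succ', Module.End.mul_apply]
          exact fun z hz => ⟨by rw [← h.apply_eq]; exact (ih z hz).2,
            by rw [h.map_left]; exact (ih _ (h.inv_mem hU hz)).2⟩
    have h0 := (hstab r _ hxP _ (hue (π i))).2
    rw [map_sum, map_sum, LinearMap.sum_apply, Finset.sum_eq_single i] at h0
    · rw [← Module.End.mul_apply, ← map_mul, hr] at h0
      simp [hc, hpair i] at h0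
    · intro j _ hj
      rw [← Module.End.mul_apply, ← map_mul, aeval_eq_sum_range]
      simp [horth i j hj]
    · simp

end Asymmetry

/-! ### Isotropic generators when `l² = 1` -/

section Isotropic

variable {F V : Type*} [Field F] [AddCommGroup V] [Module F V]

theorem apply_aeval_X_pow_mul {f : BilinForm F V} {N : End F V} {x y : V} {m : ℕ}
    (hz : ∀ i, m + 2 ≤ i → f x ((N ^ i) y) = 0) (q : F[X]) :
    f x (aeval N (X ^ m * q) y) =
      q.coeff 0 * f x ((N ^ m) y) + q.coeff 1 * f x ((N ^ (m + 1)) y) := by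
  have hs : ∀ s : F[X], f x (aeval N (X ^ (m + 2) * s) y) = 0 := by
    intro s
    induction s using Polynomial.induction_on' with
    | add s t hs ht => simp only [mul_add, map_add, LinearMap.add_apply, hs, ht, add_zero]
    | monomial n a =>
      rw [X_pow_mul_monomial, aeval_monomial, ← Algebra.smul_def, LinearMap.smul_apply, map_smul,
        hz _ (by omega), smul_zero]
  have hq : X ^ m * q = X ^ (m + 2) * q.divX.divX + C (q.coeff 0) * X ^ m +
      C (q.coeff 1) * X ^ (m + 1) := by
    have h1 := divX_mul_X_add q
    have h2 := divX_mul_X_add q.divX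
    rw [coeff_divX, zero_add] at h2
    conv_lhs => rw [← h1, ← h2]
    ring
  rw [hq, map_add, map_add, LinearMap.add_apply, LinearMap.add_apply, map_add, map_add, hs]
  simp [← Algebra.smul_def]

/-- The adjoint of `N` is `-l • τ * N`, and `τ = (N + l)⁻¹` is a polynomial in `N` because `N` is
nilpotent; thus `b = -1 + l X + ⋯`. -/
theorem IsAsymmetry.exists_polynomial {f : BilinForm F V} {σ τ : End F V}
    (h : IsAsymmetry f σ τ) {l : F} (hl : l * l = 1) {k : ℕ} (hk : 1 ≤ k)
    (hN : (σ - algebraMap F (End F V) l) ^ (k + 1) = 0) :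
    ∃ b : F[X], b.coeff 0 = -1 ∧ b.coeff 1 = l ∧ ∀ m x y,
      f (((σ - algebraMap F (End F V) l) ^ m) x) y =
        f x (aeval (σ - algebraMap F (End F V) l) (b ^ m * X ^ m) y) := by
  set N := σ - algebraMap F (End F V) l with hNdef
  have hl0 : l ≠ 0 := left_ne_zero_of_mul_eq_one hl
  have hlinv : l⁻¹ = l := inv_eq_of_mul_eq_one_right hl
  have hcop : IsCoprime (X + C l) (X ^ (k + 1) : F[X]) := by
    refine IsCoprime.pow_right ⟨C l, -C l, ?_⟩
    rw [mul_add, ← C_mul, hl]; simp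
  obtain ⟨a, d, had⟩ := hcop
  have hσ : aeval N (X + C l) = σ := by simp [hNdef]
  have ha : aeval N a = τ := by
    have := congrArg (aeval N) had
    rw [map_add, map_mul, map_mul, hσ, map_pow, aeval_X, hN, mul_zero, add_zero, map_one] at this
    rw [← mul_one (aeval N a), ← h.mul_inv, ← mul_assoc, this, one_mul]
  have hc0 : a.coeff 0 * l = 1 := by
    have := congrArg (fun p => coeff p 0) had
    simpa [mul_coeff_zero] using this
  have ha0 : a.coeff 0 = l := by
    rw [← mul_one (a.coeff 0), ← hl, ← mul_assoc, hc0, one_mul]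
  have hc1 : a.coeff 0 + a.coeff 1 * l = 0 := by
    have := congrArg (fun p => coeff p 1) had
    have hx : (d * X ^ (k + 1)).coeff 1 = 0 := by
      rw [coeff_mul_X_pow', if_neg (by omega)]
    simpa [mul_coeff_one, hx, coeff_one] using this
  refine ⟨C (-l) * a, ?_, ?_, fun m x y => ?_⟩
  · rw [coeff_C_mul, ha0]; linear_combination -hl
  · rw [coeff_C_mul]; linear_combination -hc1 + ha0
  · rw [hNdef, h.sub_pow_left hl0, hlinv, ← hNdef, map_mul, map_pow, map_pow, map_mul, ha, aeval_C,
      aeval_X, ← Algebra.smul_def, Module.End.mul_apply]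

theorem coeff_pow_of_coeff {b : F[X]} {l : F} (h0 : b.coeff 0 = -1) (h1 : b.coeff 1 = l) (m : ℕ) :
    (b ^ m).coeff 0 = (-1) ^ m ∧ (b ^ m).coeff 1 = -((-1) ^ m * m * l) := by
  induction m with
  | zero => simp [coeff_one]
  | succ m ih =>
    rw [pow_succ, mul_coeff_zero, mul_coeff_one, ih.1, ih.2, h0, h1]
    refine ⟨by ring, ?_⟩
    push_cast
    ring

/-- Kills one more value `f u (N ^ j u)` by adding to `u` a multiple of some `N ^ m v`, which
changes neither the values above `j` nor `f u (N ^ k v)`. -/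
theorem IsAsymmetry.exists_isotropic_step {f : BilinForm F V} {σ τ : End F V} [IsAlgClosed F]
    (h : IsAsymmetry f σ τ) {l : F} (hl : l * l = 1) {k : ℕ} {N : End F V}
    (hNσ : N = σ - algebraMap F (End F V) l) (hN : N ^ (k + 1) = 0)
    (halt : ∀ x, f x ((N ^ k) x) = 0) {u v : V} (huv : f u ((N ^ k) v) ≠ 0) {j : ℕ} (hj : j < k)
    (hu : ∀ i, j < i → f u ((N ^ i) u) = 0) :
    ∃ u', f u' ((N ^ k) v) ≠ 0 ∧ ∀ i, j ≤ i → f u' ((N ^ i) u') = 0 := by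
  by_cases haj : f u ((N ^ j) u) = 0
  · refine ⟨u, huv, fun i hi => ?_⟩
    rcases hi.eq_or_lt with rfl | hi
    · exact haj
    · exact hu i hi
  obtain ⟨b, hb0, hb1, hb⟩ := h.exists_polynomial hl (by omega : 1 ≤ k) (hNσ ▸ hN)
  rw [← hNσ] at hb
  have hz : ∀ i, k < i → ∀ x, (N ^ i) x = 0 := fun i hi x => by
    rw [pow_eq_zero_of_le hi hN]; rfl
  have hXpow : ∀ (p : F[X]) (m : ℕ) (x : V), aeval N p ((N ^ m) x) = aeval N (X ^ m * p) x := by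
    intro p m x
    rw [mul_comm, map_mul, map_pow, aeval_X, Module.End.mul_apply]
  have hA : ∀ a c, k ≤ a + c → f ((N ^ a) v) ((N ^ c) v) = 0 := by
    intro a c hac
    have hv : ∀ i, k ≤ i → f v ((N ^ i) v) = 0 := fun i hi => by
      rcases hi.eq_or_lt with rfl | hi
      · exact halt v
      · rw [hz i hi, map_zero]
    rw [hb, hXpow, show X ^ c * (b ^ a * X ^ a) = X ^ (a + c) * b ^ a by ring,
      apply_aeval_X_pow_mul (fun i hi => hv i (by omega)), hv _ hac, hv _ (by omega)]
    simp
  have hrel : ∀ i x y, f x ((N ^ i) y) = f y (aeval N (X ^ i * (b ^ i * (X + C l))) x) := by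
    intro i x y
    have hσ : aeval N (X + C l) = σ := by simp [hNσ]
    rw [h.apply_eq, hb, show X ^ i * (b ^ i * (X + C l)) = (b ^ i * X ^ i) * (X + C l) by ring,
      map_mul _ (b ^ i * X ^ i), hσ, Module.End.mul_apply]
  have hq0 : ∀ i : ℕ, (b ^ i * (X + C l)).coeff 0 = (-1) ^ i * l := fun i => by
    rw [mul_coeff_zero, (coeff_pow_of_coeff hb0 hb1 i).1]; simp
  have hq1 : ∀ i : ℕ, (b ^ i * (X + C l)).coeff 1 = (-1) ^ i * (1 - (i : F)) := fun i => by
    rw [mul_coeff_one, (coeff_pow_of_coeff hb0 hb1 i).1, (coeff_pow_of_coeff hb0 hb1 i).2]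
    simp
    linear_combination (-(-1) ^ i * (i : F)) * hl
  have hself : ∀ i : ℕ, j ≤ i + 1 → f u ((N ^ i) u) =
      (-1) ^ i * l * f u ((N ^ i) u) + (-1) ^ i * (1 - (i : F)) * f u ((N ^ (i + 1)) u) := by
    intro i hi
    rw [← hq0, ← hq1, ← apply_aeval_X_pow_mul (fun n hn => hu n (by omega)), ← hrel]
  have hB : ∀ i m : ℕ, k ≤ i + m + 1 → f ((N ^ m) v) ((N ^ i) u) =
      (-1) ^ i * l * f u ((N ^ (i + m)) v) + (-1) ^ i * (1 - (i : F)) * f u ((N ^ (i + m + 1)) v) := by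
    intro i m him
    rw [hrel, hXpow, ← mul_assoc, ← pow_add, add_comm m i,
      apply_aeval_X_pow_mul (fun n hn => by rw [hz n (by omega), map_zero]), hq0, hq1]
  have hexp : ∀ (c : F) (i m : ℕ), k ≤ i + m + 1 → f (u + c • (N ^ m) v) ((N ^ i) (u + c • (N ^ m) v)) =
      f u ((N ^ i) u) + c * ((1 + (-1) ^ i * l) * f u ((N ^ (i + m)) v) +
        (-1) ^ i * (1 - (i : F)) * f u ((N ^ (i + m + 1)) v)) +
        c ^ 2 * f ((N ^ m) v) ((N ^ (i + m)) v) := by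
    intro c i m him
    have : (N ^ i) ((N ^ m) v) = (N ^ (i + m)) v := by rw [pow_add, Module.End.mul_apply]
    simp only [map_add, map_smul, LinearMap.add_apply, LinearMap.smul_apply, smul_eq_mul, this,
      hB i m him]
    ring
  have hpres : ∀ (c : F) m, f (u + c • (N ^ m) v) ((N ^ k) v) ≠ 0 := by
    intro c m
    simpa [hA m k (by omega)] using huv
  -- Comparing the nonzero top value with its own transpose fixes the sign.
  have hj1 : (-1) ^ j * l = 1 := by
    have := hself j (by omega)
    rw [hu (j + 1) (by omega), mul_zero, add_zero] at this
    exact mul_right_cancel₀ haj (by rw [← this, one_mul])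
  by_cases h2 : (2 : F) = 0
  · have hneg : (-1 : F) = 1 := by linear_combination -h2
    have hl1 : l = 1 := by simpa [hneg] using hj1
    simp only [hneg, one_pow, one_mul, hl1] at hself hexp
    -- In characteristic 2, an odd `j` would force the value at `j` to vanish, by the self-relation
    -- at `j - 1`.
    have hpar : (j : F) = 0 := by
      rcases Nat.even_or_odd' j with ⟨t, rfl | rfl⟩
      · push_cast; rw [h2, zero_mul]
      · exfalso
        have := hself (2 * t) (by omega)
        push_cast at this
        rw [h2] at this
        exact haj (by linear_combination -this)
    -- The coefficient `1 + (-1) ^ j * l = 2` now vanishes, so the shift is one lower than `k - j`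
    -- and the next term, with coefficient `1 - j = 1`, supplies the linear part. The quadratic
    -- coefficient may be zero; the linear one is not, so a root exists.
    obtain ⟨m, rfl⟩ : ∃ m, k = j + m + 1 := ⟨k - j - 1, by omega⟩
    obtain ⟨c, hc⟩ := IsAlgClosed.exists_root
      (C (f ((N ^ m) v) ((N ^ (j + m)) v)) * X ^ 2 + C (f u ((N ^ (j + m + 1)) v)) * X +
        C (f u ((N ^ j) u))) (by
      intro hdeg
      have hlt : ∀ n, 0 < n → coeff (C (f ((N ^ m) v) ((N ^ (j + m)) v)) * X ^ 2 +
        C (f u ((N ^ (j + m + 1)) v)) * X + C (f u ((N ^ j) u))) n = 0 := fun n hn =>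
        coeff_eq_zero_of_degree_lt (by rw [hdeg]; exact_mod_cast hn)
      have := hlt 1 one_pos
      simp [coeff_X_pow, coeff_C] at this
      exact huv this)
    simp only [IsRoot, eval_add, eval_mul, eval_C, eval_pow, eval_X] at hc
    refine ⟨u + c • (N ^ m) v, hpres c m, fun i hi => ?_⟩
    rw [hexp c i m (by omega)]
    rcases hi.eq_or_lt with rfl | hi
    · rw [hpar]
      linear_combination hc + c * f u ((N ^ (j + m)) v) * h2
    · rw [hu i hi, hA m (i + m) (by omega), hz (i + m + 1) (by omega)]
      rcases (Nat.succ_le_of_lt hi).eq_or_lt with rfl | hi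
      · rw [show (1 + 1 : F) = 0 by linear_combination h2]; simp
      · rw [hz (i + m) (by omega)]; simp
  -- With this shift the quadratic term vanishes, leaving a linear equation for the scalar.
  · refine ⟨u + (-(f u ((N ^ j) u) / (2 * f u ((N ^ k) v)))) • (N ^ (k - j)) v, hpres _ _,
      fun i hi => ?_⟩
    rw [hexp _ i (k - j) (by omega), hA _ _ (by omega), hz (i + (k - j) + 1) (by omega)]
    rcases hi.eq_or_lt with rfl | hi
    · rw [hj1, Nat.add_sub_cancel' hj.le]
      simp
      field_simp
      ring
    · rw [hu i hi, hz (i + (k - j)) (by omega)]; simp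

theorem IsAsymmetry.exists_isotropic {f : BilinForm F V} {σ τ : End F V} [IsAlgClosed F]
    (h : IsAsymmetry f σ τ) {l : F} (hl : l * l = 1) {k : ℕ} {N : End F V}
    (hNσ : N = σ - algebraMap F (End F V) l) (hN : N ^ (k + 1) = 0)
    (halt : ∀ x, f x ((N ^ k) x) = 0) {u v : V} (huv : f u ((N ^ k) v) ≠ 0) :
    ∃ u', f u' ((N ^ k) v) ≠ 0 ∧ ∀ i, f u' ((σ ^ i) u') = 0 := by
  have hd : ∀ d, ∃ u', f u' ((N ^ k) v) ≠ 0 ∧ ∀ i, k ≤ i + d → f u' ((N ^ i) u') = 0 := by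
    intro d
    induction d with
    | zero =>
      refine ⟨u, huv, fun i hi => ?_⟩
      rcases (show k ≤ i from hi).eq_or_lt with rfl | hi
      · exact halt u
      · rw [pow_eq_zero_of_le hi hN]; simp
    | succ d ih =>
      obtain ⟨w, hw, hw'⟩ := ih
      by_cases hdk : k ≤ d
      · exact ⟨w, hw, fun i _ => hw' i (by omega)⟩
      · obtain ⟨w', h1, h2⟩ := h.exists_isotropic_step hl hNσ hN halt hw (j := k - d - 1) (by omega)
          fun i hi => hw' i (by omega)
        exact ⟨w', h1, fun i hi => h2 i (by omega)⟩
  obtain ⟨w, hw, hw'⟩ := hd k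
  refine ⟨w, hw, fun i => ?_⟩
  have hσ : aeval N (X + C l) = σ := by simp [hNσ]
  -- Powers of `σ = N + l` are polynomials in `N`, so vanishing on powers of `N` suffices.
  have := apply_aeval_X_pow_mul (f := f) (N := N) (x := w) (y := w) (m := 0)
    (fun i _ => hw' i (by omega)) ((X + C l) ^ i)
  rwa [hw' 0 (by omega), hw' (0 + 1) (by omega), mul_zero, mul_zero, add_zero, pow_zero, one_mul,
    map_pow, hσ] at this

end Isotropic

/-! ### Nondegenerate forms -/

section Nondegenerate

variable {F V : Type*} [Field F] [AddCommGroup V] [Module F V]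

namespace IsAsymmetry

variable {f : BilinForm F V} {σ τ : End F V}

theorem apply_eq_zero_of_ker_of_range (h : IsAsymmetry f σ τ) {l : F} (hl : l ≠ 0) {n : ℕ} {x : V}
    (hx : ((σ - algebraMap F (End F V) l) ^ n) x = 0) (z : V) :
    f x (((σ - algebraMap F (End F V) l⁻¹) ^ n) z) = 0 ∧
      f (((σ - algebraMap F (End F V) l⁻¹) ^ n) z) x = 0 := by
  have hr : ∀ x, ((σ - algebraMap F (End F V) l) ^ n) x = 0 →
      f (((σ - algebraMap F (End F V) l⁻¹) ^ n) z) x = 0 := by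
    intro x hx
    rw [h.sub_pow_left (inv_ne_zero hl), inv_inv, hx, map_zero, map_zero]
  refine ⟨?_, hr x hx⟩
  rw [h.apply_eq]
  refine hr _ ?_
  have hc : Commute ((σ - algebraMap F (End F V) l) ^ n) σ :=
    ((Commute.refl σ).sub_left (Algebra.commutes l σ)).pow_left n
  rw [← Module.End.mul_apply, hc.eq, Module.End.mul_apply, hx, map_zero]

/-- As `l ≠ l⁻¹`, coprimality puts the kernel of `(σ - l) ^ n` inside the range of `(σ - l⁻¹) ^ n`,
to which it is orthogonal. -/
theorem apply_pow_self_eq_zero (h : IsAsymmetry f σ τ) {l : F} (hl : l ≠ 0) (hl2 : l * l ≠ 1)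
    {n : ℕ} {x : V} (hx : ((σ - algebraMap F (End F V) l) ^ n) x = 0) (i : ℕ) :
    f x ((σ ^ i) x) = 0 := by
  have hne : l - l⁻¹ ≠ 0 := fun h0 => hl2 <|
    calc l * l = l * l⁻¹ := by rw [← sub_eq_zero.1 h0]
      _ = 1 := mul_inv_cancel₀ hl
  have hcop : IsCoprime ((X - C l) ^ n : F[X]) ((X - C l⁻¹) ^ n) :=
    (isCoprime_X_sub_C_of_isUnit_sub (isUnit_iff_ne_zero.2 hne)).pow
  obtain ⟨a, b, hab⟩ := hcop
  have hX : ∀ c, aeval σ (X - C c) = σ - algebraMap F (End F V) c := by simp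
  have hy := congrArg (fun p => aeval σ p ((σ ^ i) x)) hab
  have h1 : aeval σ (a * (X - C l) ^ n) ((σ ^ i) x) = 0 := by
    have : aeval σ (a * (X - C l) ^ n) ((σ ^ i) x) = aeval σ (a * (X - C l) ^ n * X ^ i) x := by
      rw [map_mul _ _ (X ^ i), map_pow _ X, aeval_X, Module.End.mul_apply]
    rw [this, show a * (X - C l) ^ n * X ^ i = a * X ^ i * (X - C l) ^ n by ring, map_mul,
      map_pow _ (X - C l), hX, Module.End.mul_apply, hx, map_zero]
  simp only [map_add, LinearMap.add_apply, h1, zero_add, map_one, Module.End.one_apply] at hy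
  rw [← hy, mul_comm, map_mul, map_pow, hX, Module.End.mul_apply]
  exact (h.apply_eq_zero_of_ker_of_range hl hx _).1

theorem pow_apply_pow_eq_zero (h : IsAsymmetry f σ τ) {u : V} (hu : ∀ i, f u ((σ ^ i) u) = 0)
    (m n : ℕ) : f ((σ ^ m) u) ((σ ^ n) u) = 0 := by
  rcases le_total m n with hmn | hmn
  · obtain ⟨d, rfl⟩ := Nat.exists_eq_add_of_le hmn
    rw [pow_add, Module.End.mul_apply, h.pow_map_pow_map, hu]
  · obtain ⟨d, rfl⟩ := Nat.exists_eq_add_of_le hmn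
    rw [pow_add, Module.End.mul_apply, h.pow_map_pow_map, h.apply_eq, ← Module.End.mul_apply,
      ← pow_succ', hu]

theorem apply_of_pow_succ {l : F} {k : ℕ} {u : V}
    (hu : ((σ - algebraMap F (End F V) l) ^ (k + 1)) u = 0) :
    σ (((σ - algebraMap F (End F V) l) ^ k) u) = l • ((σ - algebraMap F (End F V) l) ^ k) u := by
  rw [pow_succ', Module.End.mul_apply, LinearMap.sub_apply, sub_eq_zero] at hu
  rw [hu, Module.algebraMap_end_apply]

variable [FiniteDimensional F V]

theorem equivalent_flip_of_isotropic_pair (h : IsAsymmetry f σ τ)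
    (hI : ∀ W : Submodule F V, W ≠ ⊤ → ∀ g : BilinForm F W, g.Equivalent g.flip)
    {l : F} (hl : l ≠ 0) {k : ℕ} {u v : V}
    (hu : ((σ - algebraMap F (End F V) l) ^ (k + 1)) u = 0)
    (hv : ((σ - algebraMap F (End F V) l⁻¹) ^ (k + 1)) v = 0)
    (huv : f (((σ - algebraMap F (End F V) l) ^ k) u) v ≠ 0)
    (hui : ∀ i, f u ((σ ^ i) u) = 0) (hvi : ∀ i, f v ((σ ^ i) v) = 0) : f.Equivalent f.flip := by
  have hu' := h.pow_apply_pow_eq_zero hui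
  have hv' := h.pow_apply_pow_eq_zero hvi
  refine h.equivalent_flip_of_generators hI (ι := Bool) (u := fun b => cond b u v) not
    (l := fun b => cond b l l⁻¹) (k := fun _ => k) ?_ ?_ ?_ ?_
  · rintro (_ | _)
    · exact hv
    · exact hu
  · rintro (_ | _)
    · change f (((σ - algebraMap F (End F V) l⁻¹) ^ k) v) u ≠ 0
      -- The end `w` of the chain is an eigenvector of `σ` and `τ`, so the adjoint formula gives a
      -- nonzero multiple of `f w v`.
      set w := ((σ - algebraMap F (End F V) l) ^ k) u with hw
      have hσw : σ w = l • w := apply_of_pow_succ hu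
      have hτw : τ w = l⁻¹ • w := by
        rw [eq_inv_smul_iff₀ hl, ← map_smul, ← hσw, h.inv_apply]
      have hpow : ∀ n, ((-l⁻¹ • τ) ^ n) w = ((-l⁻¹ * l⁻¹) ^ n) • w := by
        intro n
        induction n with
        | zero => simp
        | succ n ih =>
          rw [pow_succ', Module.End.mul_apply, ih, map_smul, LinearMap.smul_apply, hτw, smul_smul,
            smul_smul, pow_succ]
          congr 1
          ring
      rw [h.sub_pow_left (inv_ne_zero hl), inv_inv, ← hw, hpow, map_smul]
      rw [h.apply_eq, hσw, map_smul] at huv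
      exact smul_ne_zero (pow_ne_zero _ (mul_ne_zero (neg_ne_zero.2 (inv_ne_zero hl))
        (inv_ne_zero hl))) (right_ne_zero_of_smul huv)
    · exact huv
  · rintro (_ | _) (_ | _) hij n
    · exact absurd rfl hij
    · exact hu' n 0
    · exact hv' n 0
    · exact absurd rfl hij
  · rintro (_ | _) (_ | _) m n
    · exact (hu' m n).trans (hv' m n).symm
    · rfl
    · rfl
    · exact (hv' m n).trans (hu' m n).symm

theorem equivalent_flip_of_isNilpotent [IsAlgClosed F] [Nontrivial V] (h : IsAsymmetry f σ τ)
    (hf : ∀ x, (∀ y, f y x = 0) → x = 0)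
    (hI : ∀ W : Submodule F V, W ≠ ⊤ → ∀ g : BilinForm F W, g.Equivalent g.flip)
    {l : F} (hl : l * l = 1) (hN : IsNilpotent (σ - algebraMap F (End F V) l)) :
    f.Equivalent f.flip := by
  set N := σ - algebraMap F (End F V) l with hNσ
  have hl0 : l ≠ 0 := left_ne_zero_of_mul_eq_one hl
  have hlinv : l⁻¹ = l := inv_eq_of_mul_eq_one_right hl
  obtain ⟨k, hk⟩ : ∃ k, nilpotencyClass N = k + 1 :=
    Nat.exists_eq_succ_of_ne_zero (pos_nilpotencyClass_iff.2 hN).ne'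
  have hk1 : N ^ (k + 1) = 0 := hk ▸ pow_nilpotencyClass hN
  have hk0 : N ^ k ≠ 0 := by simpa [hk] using pow_pred_nilpotencyClass hN
  have hz : ∀ x, (N ^ (k + 1)) x = 0 := fun x => by rw [hk1]; rfl
  have hswap : ∀ x y, f ((N ^ k) x) y = l * f y ((N ^ k) x) := fun x y => by
    rw [h.apply_eq, apply_of_pow_succ (hz x), map_smul, smul_eq_mul]
  by_cases halt : ∀ x, f x ((N ^ k) x) = 0
  · obtain ⟨v, hv⟩ : ∃ v, (N ^ k) v ≠ 0 := by
      by_contra! hcon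
      exact hk0 (LinearMap.ext hcon)
    obtain ⟨u, hu⟩ : ∃ u, f u ((N ^ k) v) ≠ 0 := by
      by_contra! hcon
      exact hv (hf _ hcon)
    obtain ⟨u', hu', hu'i⟩ := h.exists_isotropic hl hNσ hk1 halt hu
    -- The alternating form is skew, so `u'` and `v` can exchange roles and `v` be made isotropic
    -- too.
    have hvu : f v ((N ^ k) u') ≠ 0 := by
      have := halt (u' + v)
      simp only [map_add, LinearMap.add_apply, halt, zero_add, add_zero] at this
      intro h0
      rw [h0, zero_add] at this
      exact hu' this
    obtain ⟨v', hv', hv'i⟩ := h.exists_isotropic hl hNσ hk1 halt hvu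
    refine h.equivalent_flip_of_isotropic_pair hI hl0 (hz u') ?_ ?_ hu'i hv'i
    · rw [hlinv]; exact hz v'
    · rw [← hNσ, hswap]; exact mul_ne_zero hl0 hv'
  · obtain ⟨x, hx⟩ := not_forall.1 halt
    refine h.equivalent_flip_of_generators hI (ι := Unit) (u := fun _ => x) (π := _root_.id) (l := fun _ => l)
      (k := fun _ => k) (fun _ => hz x) (fun _ => ?_)
      (fun i j hij => absurd (Subsingleton.elim j i) hij) (fun _ _ _ _ => rfl)
    rw [← hNσ, hswap]; exact mul_ne_zero hl0 hx

theorem equivalent_flip_of_mul_self_ne_one (h : IsAsymmetry f σ τ)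
    (hf : ∀ x, (∀ y, f x y = 0) → x = 0)
    (hI : ∀ W : Submodule F V, W ≠ ⊤ → ∀ g : BilinForm F W, g.Equivalent g.flip)
    {l : F} (hl0 : l ≠ 0) (hl : l * l ≠ 1) (hev : σ.HasEigenvalue l) : f.Equivalent f.flip := by
  set N := σ - algebraMap F (End F V) l with hNσ
  set M := σ - algebraMap F (End F V) l⁻¹
  obtain ⟨x, hx⟩ := hev.exists_hasEigenvector
  have hNx : N x = 0 := by rw [hNσ, LinearMap.sub_apply, hx.apply_eq_smul]; simp
  obtain ⟨n, ⟨hnN, hnM⟩, hn⟩ := ((N.eventually_isCompl_ker_pow_range_pow.and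
    M.eventually_isCompl_ker_pow_range_pow).and (Filter.eventually_ge_atTop 1)).exists
  classical
  have hex : ∃ K, ∀ y, (N ^ n) y = 0 → (N ^ K) y = 0 := ⟨n, fun y hy => hy⟩
  have hspec := Nat.find_spec hex
  obtain ⟨k, hk⟩ : ∃ k, Nat.find hex = k + 1 := by
    refine Nat.exists_eq_succ_of_ne_zero fun h0 => hx.2 ?_
    rw [h0] at hspec
    refine hspec x ?_
    rw [← Nat.sub_add_cancel hn, pow_succ, Module.End.mul_apply, hNx, map_zero]
  rw [hk] at hspec
  obtain ⟨u, hun, hu⟩ : ∃ u, (N ^ n) u = 0 ∧ (N ^ k) u ≠ 0 := by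
    have := Nat.find_min hex (m := k) (by omega)
    push Not at this
    exact this
  have hNw : (N ^ n) ((N ^ k) u) = 0 := by
    rw [← Module.End.mul_apply, (Commute.pow_pow_self N n k).eq, Module.End.mul_apply, hun, map_zero]
  obtain ⟨v₀, hv₀⟩ : ∃ v, f ((N ^ k) u) v ≠ 0 := by
    by_contra! hcon
    exact hu (hf _ hcon)
  obtain ⟨v, hv, _, ⟨z, rfl⟩, rfl⟩ := Submodule.mem_sup.1
    ((codisjoint_iff.1 hnM.codisjoint).ge (Submodule.mem_top (x := v₀)))
  rw [LinearMap.mem_ker] at hv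
  rw [map_add, (h.apply_eq_zero_of_ker_of_range hl0 hNw z).1, add_zero] at hv₀
  -- The exponent `k + 1` kills the generalized `l`-eigenspace; by adjunction it kills `v`, which is
  -- orthogonal to the range of `N ^ n`.
  have hvk : (M ^ (k + 1)) v = 0 := by
    refine hf _ fun y => ?_
    rw [h.sub_pow_left (inv_ne_zero hl0), inv_inv, ← hNσ]
    have hc : Commute ((-l⁻¹ • τ) ^ (k + 1)) (N ^ (k + 1)) :=
      (((h.commute.symm.sub_right (Algebra.commutes _ _).symm).smul_left _).pow_left _).pow_right _
    rw [← Module.End.mul_apply, hc.eq, Module.End.mul_apply]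
    obtain ⟨y₁, hy₁, _, ⟨y₂, rfl⟩, hy⟩ := Submodule.mem_sup.1 ((codisjoint_iff.1
      hnN.codisjoint).ge (Submodule.mem_top (x := ((-l⁻¹ • τ) ^ (k + 1)) y)))
    rw [← hy, map_add, hspec _ hy₁, zero_add, ← Module.End.mul_apply,
      (Commute.pow_pow_self N _ _).eq, Module.End.mul_apply]
    have := (h.apply_eq_zero_of_ker_of_range (inv_ne_zero hl0) hv ((N ^ (k + 1)) y₂)).1
    rwa [inv_inv] at this
  have hlinv : l⁻¹ * l⁻¹ ≠ 1 := fun h0 => hl (by rw [← _root_.mul_inv] at h0; exact inv_eq_one.1 h0)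
  exact h.equivalent_flip_of_isotropic_pair hI hl0 (hspec u hun) hvk hv₀
    (h.apply_pow_self_eq_zero hl0 hl hun) (h.apply_pow_self_eq_zero (inv_ne_zero hl0) hlinv hv)

theorem equivalent_flip_of_mul_self_eq_one [IsAlgClosed F] (h : IsAsymmetry f σ τ)
    (hf : ∀ x, (∀ y, f y x = 0) → x = 0)
    (hI : ∀ W : Submodule F V, W ≠ ⊤ → ∀ g : BilinForm F W, g.Equivalent g.flip)
    {l : F} (hl : l * l = 1) (hev : σ.HasEigenvalue l) : f.Equivalent f.flip := by
  set N := σ - algebraMap F (End F V) l with hNσ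
  have hl0 : l ≠ 0 := left_ne_zero_of_mul_eq_one hl
  have hlinv : l⁻¹ = l := inv_eq_of_mul_eq_one_right hl
  obtain ⟨x, hx⟩ := hev.exists_hasEigenvector
  have : Nontrivial V := ⟨x, 0, hx.2⟩
  have hNx : N x = 0 := by rw [hNσ, LinearMap.sub_apply, hx.apply_eq_smul]; simp
  obtain ⟨n, hnN, hn⟩ := (N.eventually_isCompl_ker_pow_range_pow.and
    (Filter.eventually_ge_atTop 1)).exists
  by_cases hnil : LinearMap.ker (N ^ n) = ⊤
  · exact h.equivalent_flip_of_isNilpotent hf hI hl ⟨n, LinearMap.ker_eq_top.1 hnil⟩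
  · refine equivalent_flip_of_isCompl hnN ?_ (hI _ hnil _) (hI _ ?_ _)
    · rintro u hu _ ⟨z, rfl⟩
      have := h.apply_eq_zero_of_ker_of_range hl0 hu z
      rwa [hlinv] at this
    · intro htop
      have hker : x ∈ LinearMap.ker (N ^ n) := by
        rw [LinearMap.mem_ker, ← Nat.sub_add_cancel hn, pow_succ, Module.End.mul_apply, hNx,
          map_zero]
      exact hx.2 (Submodule.disjoint_def.1 hnN.disjoint x hker (htop ▸ Submodule.mem_top))

end IsAsymmetry

variable [FiniteDimensional F V]

theorem exists_isAsymmetry {f : BilinForm F V} (hf : ∀ x, (∀ y, f x y = 0) → x = 0) :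
    (∃ σ τ, IsAsymmetry f σ τ) ∧ ∀ x, (∀ y, f y x = 0) → x = 0 := by
  have hdim : finrank F V = finrank F (Dual F V) := (Subspace.dual_finrank_eq (K := F) (V := V)).symm
  have hinj : Function.Injective f := by
    rw [← LinearMap.ker_eq_bot, LinearMap.ker_eq_bot']
    exact fun x hx => hf x fun y => LinearMap.congr_fun hx y
  have hsurj := (LinearMap.injective_iff_surjective_of_finrank_eq_finrank hdim).1 hinj
  have hf' : ∀ x, (∀ y, f y x = 0) → x = 0 := fun x hx => by
    rw [← Module.forall_dual_apply_eq_zero_iff F]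
    intro φ
    obtain ⟨y, rfl⟩ := hsurj φ
    exact hx y
  refine ⟨?_, hf'⟩
  have hinj' : Function.Injective f.flip := by
    rw [← LinearMap.ker_eq_bot, LinearMap.ker_eq_bot']
    exact fun x hx => hf' x fun y => LinearMap.congr_fun hx y
  have hsurj' := (LinearMap.injective_iff_surjective_of_finrank_eq_finrank hdim).1 hinj'
  let E := LinearEquiv.ofBijective f ⟨hinj, hsurj⟩
  let E' := LinearEquiv.ofBijective f.flip ⟨hinj', hsurj'⟩
  refine ⟨(E.trans E'.symm : V ≃ₗ[F] V), (E'.trans E.symm : V ≃ₗ[F] V), ?_, ?_, ?_⟩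
  · intro x y
    have : E' (E'.symm (E x)) = E x := E'.apply_symm_apply _
    exact (LinearMap.congr_fun this y).symm
  · ext x; simp
  · ext x; simp

theorem equivalent_flip_of_separatingLeft [IsAlgClosed F] {f : BilinForm F V}
    (hf : ∀ x, (∀ y, f x y = 0) → x = 0)
    (hI : ∀ W : Submodule F V, W ≠ ⊤ → ∀ g : BilinForm F W, g.Equivalent g.flip) :
    f.Equivalent f.flip := by
  obtain ⟨⟨σ, τ, h⟩, hf'⟩ := exists_isAsymmetry hf
  rcases subsingleton_or_nontrivial V with hV | hV
  · exact equivalent_flip_iff.2 ⟨LinearEquiv.refl F V, fun x y => by rw [Subsingleton.elim x y]; rfl⟩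
  obtain ⟨l, hev⟩ := Module.End.exists_eigenvalue σ
  have hl0 : l ≠ 0 := by
    rintro rfl
    obtain ⟨x, hx⟩ := hev.exists_hasEigenvector
    refine hx.2 ?_
    rw [← h.inv_apply x, hx.apply_eq_smul, zero_smul, map_zero]
  by_cases hl : l * l = 1
  · exact h.equivalent_flip_of_mul_self_eq_one hf' hI hl hev
  · exact h.equivalent_flip_of_mul_self_ne_one hf hI hl0 hl hev

end Nondegenerate

/-! ### Null chains and singular summands -/

section Chains

variable {F V : Type*} [Field F] [AddCommGroup V] [Module F V]

/-- The coefficients of a vector in the kernel of the pencil `f.flip - t f`. -/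
structure IsNullChain (f : BilinForm F V) (x : ℕ → V) : Prop where
  zero : ∀ y, f y (x 0) = 0
  succ : ∀ i y, f y (x (i + 1)) = f (x i) y

theorem IsNullChain.apply_apply {f : BilinForm F V} {x : ℕ → V} (hx : f.IsNullChain x) (i j : ℕ) :
    f (x i) (x j) = 0 := by
  induction i generalizing j with
  | zero =>
    cases j with
    | zero => exact hx.zero _
    | succ j => rw [hx.succ, hx.zero]
  | succ i ih =>
    cases j with
    | zero => exact hx.zero _
    | succ j => rw [hx.succ, hx.succ, ih]

variable [FiniteDimensional F V]

/-- Duality for a linear system, solved one step at a time: the hypothesis makes `φ` factor through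
`f` modulo the functionals `f.flip (z 0)`. By reflexivity the factor is evaluation at some `v`,
which starts the new chain, and `f v` satisfies the hypothesis for `m - 1`. -/
theorem exists_chain_of_forall_apply_eq_zero (f : BilinForm F V) (m : ℕ) (φ : Dual F V)
    (hφ : ∀ z : ℕ → V, (∀ j < m, ∀ y, f y (z (j + 1)) = f (z j) y) → φ (z 0) = 0) :
    ∃ y : ℕ → V, (∀ t, φ t = f t (y 0)) ∧ (∀ j t, f t (y (j + 1)) = f (y j) t) ∧
      ∀ j, m ≤ j → y j = 0 := by
  induction m generalizing φ with
  | zero => exact ⟨0, fun t => by simpa using hφ (fun _ => t) (by simp), by simp, by simp⟩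
  | succ m ih =>
    let D : Submodule F V :=
      { carrier := {w | ∃ z : ℕ → V, z 0 = w ∧ ∀ j < m, ∀ y, f y (z (j + 1)) = f (z j) y}
        add_mem' := by
          rintro _ _ ⟨z, rfl, hz⟩ ⟨z', rfl, hz'⟩
          exact ⟨z + z', rfl, fun j hj y => by simp [hz j hj, hz' j hj]⟩
        zero_mem' := ⟨0, rfl, by simp⟩
        smul_mem' := by
          rintro c _ ⟨z, rfl, hz⟩
          exact ⟨c • z, rfl, fun j hj y => by simp [hz j hj]⟩ }
    let S : Submodule F (Dual F V) := D.map f.flip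
    have hmem : φ ∈ LinearMap.range (S.mkQ ∘ₗ f : V →ₗ[F] _).dualMap := by
      rw [LinearMap.range_dualMap_eq_dualAnnihilator_ker, Submodule.mem_dualAnnihilator]
      intro w hw
      rw [LinearMap.mem_ker, LinearMap.comp_apply, Submodule.mkQ_apply,
        Submodule.Quotient.mk_eq_zero] at hw
      obtain ⟨_, ⟨z, rfl, hz⟩, hzw⟩ := hw
      refine hφ (fun n => Nat.casesOn n w z) fun j hj y => ?_
      cases j with
      | zero => exact LinearMap.congr_fun hzw y
      | succ j => exact hz j (by omega) y
    obtain ⟨ψ, hψ⟩ := hmem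
    obtain ⟨v, hv⟩ := (Module.evalEquiv F V).surjective (ψ ∘ₗ S.mkQ)
    have hv' : ∀ g : Dual F V, ψ (S.mkQ g) = g v := fun g => (LinearMap.congr_fun hv g).symm
    have hφv : ∀ t, φ t = f t v := fun t => by rw [← hψ, ← hv']; rfl
    obtain ⟨y, hy0, hy, hym⟩ := ih (f v) fun z hz => by
      have : f.flip (z 0) ∈ S := ⟨z 0, ⟨z, rfl, hz⟩, rfl⟩
      change f.flip (z 0) v = 0
      rw [← hv', Submodule.mkQ_apply, (Submodule.Quotient.mk_eq_zero S).2 this, map_zero]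
    refine ⟨fun n => Nat.casesOn n v y, hφv, ?_, ?_⟩
    · rintro (_ | j) t
      · exact (hy0 t).symm
      · exact hy j t
    · rintro (_ | j) hj
      · omega
      · exact hym j (by omega)

/-- The chain relations make the pairings of the `z j` with the `x i` a shifted identity and the
Gram matrix of the `z j` Toeplitz; the `x i` are mutually orthogonal. Reversing both chains
transposes all of this. -/
theorem equivalent_flip_of_dual_chains {f : BilinForm F V}
    (hI : ∀ W : Submodule F V, W ≠ ⊤ → ∀ g : BilinForm F W, g.Equivalent g.flip)
    {m : ℕ} {x z : ℕ → V} (hx : f.IsNullChain x) (hxm : ∀ i, m + 1 < i → x i = 0)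
    (hz : ∀ j < m, ∀ y, f y (z (j + 1)) = f (z j) y) (hzx : f (z 0) (x 1) ≠ 0) :
    f.Equivalent f.flip := by
  classical
  obtain ⟨c, hc⟩ : ∃ c, f (z 0) (x 1) = c := ⟨_, rfl⟩
  rw [hc] at hzx
  have hxz : ∀ i j, f (x i) (z j) = f (z j) (x (i + 1)) := fun i j => (hx.succ i _).symm
  have hshift : ∀ d j i, j + d ≤ m → f (z (j + d)) (x (i + d)) = f (z j) (x i) := by
    intro d j i hd
    induction d with
    | zero => rfl
    | succ d ih => rw [← add_assoc, ← add_assoc, hx.succ, hz _ (by omega), ih (by omega)]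
  have hpair : ∀ j i, j ≤ m → f (z j) (x i) = if i = j + 1 then c else 0 := by
    intro j i hj
    split_ifs with hij
    · subst hij
      have := hshift j 0 1 (by omega)
      rwa [zero_add, add_comm 1 j, hc] at this
    · rcases Nat.lt_or_ge j i with h | h
      · rw [← hshift (m - j) j i (by omega), hxm _ (by omega), map_zero]
      · have := hshift i (j - i) 0 (by omega)
        rwa [Nat.sub_add_cancel h, zero_add, hx.zero] at this
  have hzshift : ∀ d i j, i + d ≤ m → j + d ≤ m → f (z (i + d)) (z (j + d)) = f (z i) (z j) := by
    intro d i j hi hj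
    induction d with
    | zero => rfl
    | succ d ih =>
      rw [← add_assoc, ← add_assoc, hz _ (by omega), hz _ (by omega), ih (by omega) (by omega)]
  have hzrev : ∀ i j, i ≤ m → j ≤ m → f (z (m - i)) (z (m - j)) = f (z j) (z i) := by
    intro i j hi hj
    rcases le_total (i + j) m with h | h
    · rw [← hzshift (m - (i + j)) j i (by omega) (by omega)]
      congr 3 <;> omega
    · rw [← hzshift (i + j - m) (m - i) (m - j) (by omega) (by omega)]
      congr 3 <;> omega
  let e : Fin (m + 2) ⊕ Fin (m + 1) → V := Sum.elim (fun i => x i) fun j => z j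
  let e' : Fin (m + 2) ⊕ Fin (m + 1) → V :=
    Sum.elim (fun i => x (m + 1 - i)) fun j => z (m - j)
  have hxe : ∀ i, x i ∈ Submodule.span F (Set.range e) := by
    intro i
    rcases Nat.lt_or_ge (m + 1) i with h | h
    · rw [hxm i h]; exact zero_mem _
    · exact Submodule.subset_span ⟨Sum.inl ⟨i, by omega⟩, rfl⟩
  have hze : ∀ j, j ≤ m → z j ∈ Submodule.span F (Set.range e) := fun j hj =>
    Submodule.subset_span ⟨Sum.inr ⟨j, by omega⟩, rfl⟩
  -- The chain relations reduce biorthogonality to `2m + 3` conditions, as many as there are vectors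
  -- in `e`.
  have hbi : ∀ w, w ∈ f.biorthogonal (Submodule.span F (Set.range e)) ↔
      (∀ i ≤ m, f w (x (i + 1)) = 0) ∧ (∀ j ≤ m, f (z j) w = 0) ∧ f w (z 0) = 0 := by
    intro w
    rw [mem_biorthogonal_span]
    constructor
    · intro h
      exact ⟨fun i hi => (h _ ⟨Sum.inl ⟨i + 1, by omega⟩, rfl⟩).2,
        fun j hj => (h _ ⟨Sum.inr ⟨j, by omega⟩, rfl⟩).1, (h _ ⟨Sum.inr 0, rfl⟩).2⟩
    · rintro ⟨h1, h2, h3⟩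
      have h1' : ∀ i, f w (x i) = 0 := by
        rintro (_ | i)
        · exact hx.zero _
        · rcases Nat.lt_or_ge m i with h | h
          · rw [hxm _ (by omega), map_zero]
          · exact h1 i h
      rintro _ ⟨⟨i, hi⟩ | ⟨j, hj⟩, rfl⟩
      · exact ⟨(hx.succ i w).symm.trans (h1' _), h1' i⟩
      · refine ⟨h2 j (by omega), ?_⟩
        cases j with
        | zero => exact h3
        | succ j => exact (hz j (by omega) w).trans (h2 j (by omega))
  have hS1 : ∀ (b : Fin (m + 1) → F) (i : Fin (m + 1)),
      f (∑ j, b j • z j) (x (i + 1)) = b i * c := by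
    intro b i
    rw [map_sum, LinearMap.sum_apply, Finset.sum_eq_single i]
    · simp [hpair i (i + 1) (by omega)]
    · intro j _ hj
      have : (i : ℕ) ≠ j := fun h => hj (Fin.ext h.symm)
      simp [hpair j (i + 1) (by omega), this]
    · simp
  have hS2 : ∀ (a : Fin (m + 2) → F) (j : Fin (m + 1)),
      f (z j) (∑ i, a i • x i) = a j.succ * c := by
    intro a j
    rw [map_sum, Finset.sum_eq_single j.succ]
    · simp [hpair j (j + 1) (by omega)]
    · intro i _ hi
      have : (i : ℕ) ≠ j + 1 := fun h => hi (Fin.ext (by simpa using h))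
      simp [hpair j i (by omega), this]
    · simp
  have hS3 : ∀ a : Fin (m + 2) → F, f (∑ i, a i • x i) (z 0) = a 0 * c := by
    intro a
    rw [map_sum, LinearMap.sum_apply, Finset.sum_eq_single 0]
    · simp [hxz, hc]
    · intro i _ hi
      have : (i : ℕ) ≠ 0 := fun h => hi (Fin.ext h)
      simp [hxz, hpair 0 (i + 1) (by omega), this]
    · simp
  have hS0 : ∀ (a : Fin (m + 2) → F) (t : ℕ), f (∑ i, a i • x i) (x t) = 0 := by
    intro a t
    simp [map_sum, LinearMap.sum_apply, hx.apply_apply]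
  refine equivalent_flip_of_family (e := e) (e' := e') hI ⟨Sum.inr 0, fun h0 => ?_⟩ ?_ ?_ ⟨?_, ?_⟩
  · have : z 0 = 0 := h0
    rw [this] at hc
    exact hzx (by simpa using hc.symm)
  · rintro (i | j)
    · exact hxe _
    · exact hze _ (by omega)
  · rintro (i | i) (j | j)
    · exact (hx.apply_apply _ _).trans (hx.apply_apply _ _).symm
    · change f (x (m + 1 - i)) (z (m - j)) = f (z j) (x i)
      rw [hxz, hpair _ _ (by omega), hpair _ _ (by omega)]
      congr 1
      rw [eq_iff_iff]
      omega
    · change f (z (m - i)) (x (m + 1 - j)) = f (x j) (z i)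
      rw [hxz, hpair _ _ (by omega), hpair _ _ (by omega)]
      congr 1
      rw [eq_iff_iff]
      omega
    · exact hzrev i j (by omega) (by omega)
  · rw [Submodule.disjoint_def]
    intro w hw hwb
    obtain ⟨a, rfl⟩ := (Submodule.mem_span_range_iff_exists_fun F).1 hw
    rw [hbi] at hwb
    have hsplit : ∑ i, a i • e i =
        ∑ i, a (Sum.inl i) • x i + ∑ j, a (Sum.inr j) • z j := by
      rw [Fintype.sum_sum_type]; rfl
    rw [hsplit] at hwb ⊢
    have hb : ∀ j, a (Sum.inr j) = 0 := by
      intro j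
      have := hwb.1 j (by omega)
      rw [map_add, LinearMap.add_apply, hS0, hS1, zero_add] at this
      exact (mul_eq_zero.1 this).resolve_right hzx
    have ha : ∀ i, a (Sum.inl i) = 0 := by
      intro i
      obtain ⟨-, h2, h3⟩ := hwb
      simp only [hb, zero_smul, Finset.sum_const_zero, add_zero] at h2 h3
      refine Fin.cases ?_ (fun j => ?_) i
      · rw [hS3] at h3
        exact (mul_eq_zero.1 h3).resolve_right hzx
      · have := h2 j (by omega)
        rw [hS2] at this
        exact (mul_eq_zero.1 this).resolve_right hzx
    simp [ha, hb]
  · rw [codisjoint_iff, eq_top_iff]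
    intro v _
    -- The system is triangular: `w₁` corrects the pairings with the `x i`, and `w₂`, a combination
    -- of the mutually orthogonal `x i`, then corrects those with the `z j` without disturbing them.
    let w₁ := ∑ j : Fin (m + 1), (f v (x (j + 1)) / c) • z j
    let a : Fin (m + 2) → F :=
      Fin.cons (f (v - w₁) (z 0) / c) fun j : Fin (m + 1) => f (z j) (v - w₁) / c
    have ha0 : a 0 = f (v - w₁) (z 0) / c := rfl
    have ha1 : ∀ j, a (Fin.succ j) = f (z j) (v - w₁) / c := fun _ => rfl
    let w₂ := ∑ i : Fin (m + 2), a i • x i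
    refine Submodule.mem_sup.2 ⟨w₁ + w₂, add_mem ?_ ?_, v - w₁ - w₂, (hbi _).2 ⟨?_, ?_, ?_⟩, by abel⟩
    · exact Submodule.sum_mem _ fun j _ => Submodule.smul_mem _ _ (hze _ (by omega))
    · exact Submodule.sum_mem _ fun i _ => Submodule.smul_mem _ _ (hxe _)
    · intro i hi
      have := hS1 (fun j => f v (x (j + 1)) / c) ⟨i, by omega⟩
      rw [map_sub, map_sub, LinearMap.sub_apply, LinearMap.sub_apply, hS0, this,
        div_mul_cancel₀ _ hzx]
      simp
    · intro j hj
      have := hS2 a ⟨j, by omega⟩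
      rw [map_sub, this, ha1, div_mul_cancel₀ _ hzx, sub_self]
    · rw [map_sub, LinearMap.sub_apply, hS3, ha0, div_mul_cancel₀ _ hzx, sub_self]

theorem equivalent_flip_of_isNullChain {f : BilinForm F V}
    (hI : ∀ W : Submodule F V, W ≠ ⊤ → ∀ g : BilinForm F W, g.Equivalent g.flip)
    {x : ℕ → V} (hx : f.IsNullChain x) (hx0 : x 0 ≠ 0) {n : ℕ} (hxn : ∀ i, n < i → x i = 0) :
    f.Equivalent f.flip := by
  classical
  have hex : ∃ n, ∃ x, f.IsNullChain x ∧ x 0 ≠ 0 ∧ ∀ i, n < i → x i = 0 := ⟨n, x, hx, hx0, hxn⟩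
  clear! x
  obtain ⟨x, hx, hx0, hxn⟩ := Nat.find_spec hex
  rcases Nat.eq_zero_or_eq_succ_pred (Nat.find hex) with h0 | hm
  · obtain ⟨W, hW⟩ := Submodule.exists_isCompl (Submodule.span F {x 0})
    have hl : ∀ y, f (x 0) y = 0 := fun y => by
      rw [← hx.succ, hxn 1 (by omega), map_zero]
    have hrad : ∀ u ∈ Submodule.span F {x 0}, ∀ w, f u w = 0 ∧ f w u = 0 := by
      intro u hu w
      obtain ⟨a, rfl⟩ := Submodule.mem_span_singleton.1 hu
      simp [hl, hx.zero]
    refine equivalent_flip_of_isCompl hW (fun u hu w _ => hrad u hu w)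
      (equivalent_flip_iff.2 ⟨LinearEquiv.refl F _, fun u v =>
        (hrad u u.2 v).1.trans (hrad u u.2 v).2.symm⟩) (hI _ ?_ _)
    rintro rfl
    exact hx0 (Submodule.disjoint_def.1 hW.disjoint _ (Submodule.mem_span_singleton_self _)
      Submodule.mem_top)
  · set m := (Nat.find hex).pred
    by_cases hz : ∃ z : ℕ → V, (∀ j < m, ∀ y, f y (z (j + 1)) = f (z j) y) ∧ f (z 0) (x 1) ≠ 0
    · obtain ⟨z, hz, hzx⟩ := hz
      exact equivalent_flip_of_dual_chains hI hx (fun i hi => hxn i (by omega)) hz hzx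
    · exfalso
      push Not at hz
      -- Without a dual chain, the tail of `x` after `x 0` could be replaced by a shorter one,
      -- against minimality.
      obtain ⟨y, hy0, hy, hym⟩ := exists_chain_of_forall_apply_eq_zero f m (f.flip (x 1)) hz
      refine Nat.find_min hex (m := m) (by omega)
        ⟨fun n => Nat.casesOn n (x 0) y, ⟨hx.zero, ?_⟩, hx0, ?_⟩
      · rintro (_ | i) t
        · exact (hy0 t).symm.trans (hx.succ 0 t)
        · exact hy i t
      · rintro (_ | i) hi
        · omega
        · exact hym i (by omega)

end Chains

/-! ### The pencil dichotomy and the induction -/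

section Main

theorem exists_isNullChain {F V : Type*} [Field F] [Infinite F] [AddCommGroup V] [Module F V]
    [FiniteDimensional F V] {f : BilinForm F V}
    (hf : ∀ l : F, l * l ≠ 1 → ∃ x ≠ 0, ∀ y, f x y - l * f y x = 0) :
    ∃ x, f.IsNullChain x ∧ x 0 ≠ 0 ∧ ∃ n, ∀ i, n < i → x i = 0 := by
  classical
  let b := Module.finBasis F V
  let A : Matrix (Fin (finrank F V)) (Fin (finrank F V)) F := Matrix.of fun i j => f (b i) (b j)
  let P : Matrix (Fin (finrank F V)) (Fin (finrank F V)) F[X] :=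
    Matrix.of fun i j => C (A i j) - X * C (A j i)
  have hdet : P.det = 0 := by
    -- The extra factor covers the `l` with `l² = 1`, about which nothing is assumed.
    have hzero : P.det * (X * X - 1) = 0 := by
      refine Polynomial.funext fun l => ?_
      rw [eval_mul, eval_zero, mul_eq_zero, or_iff_not_imp_right]
      intro hl
      obtain ⟨x, hx, hxl⟩ := hf l fun h => hl (by simp [h])
      rw [← coe_evalRingHom, RingHom.map_det, ← Matrix.exists_vecMul_eq_zero_iff]
      refine ⟨b.repr x, fun h => hx (b.repr.map_eq_zero_iff.1 (DFunLike.coe_injective h)), ?_⟩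
      funext j
      have := hxl (b j)
      rw [← b.sum_repr x, map_sum, map_sum, LinearMap.sum_apply, Finset.mul_sum,
        ← Finset.sum_sub_distrib] at this
      simp only [Matrix.vecMul, dotProduct, RingHom.mapMatrix_apply, Matrix.map_apply, P, A,
        Matrix.of_apply, coe_evalRingHom, eval_sub, eval_mul, eval_C, eval_X, Pi.zero_apply]
      rw [← this]
      refine Finset.sum_congr rfl fun i _ => ?_
      simp only [map_smul, LinearMap.smul_apply, smul_eq_mul]
      ring
    refine (mul_eq_zero.1 hzero).resolve_right fun h => ?_
    have := congrArg (fun p => coeff p 0) h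
    simp at this
  obtain ⟨v, hv0, hv⟩ := Matrix.exists_mulVec_eq_zero_iff.2 hdet
  let x : ℕ → V := fun t => ∑ j, (v j).coeff t • b j
  have hrow : ∀ i, (∑ j, C (A i j) * v j) = X * ∑ j, C (A j i) * v j := by
    intro i
    have := congrFun hv i
    simp only [Matrix.mulVec, dotProduct, P, Matrix.of_apply, Pi.zero_apply, sub_mul,
      Finset.sum_sub_distrib, sub_eq_zero] at this
    rw [this, Finset.mul_sum]
    exact Finset.sum_congr rfl fun j _ => by ring
  have hleft : ∀ t i, f (b i) (x t) = (∑ j, C (A i j) * v j).coeff t := by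
    intro t i
    simp [x, A, mul_comm]
  have hright : ∀ t i, f (x t) (b i) = (∑ j, C (A j i) * v j).coeff t := by
    intro t i
    simp [x, A, mul_comm]
  have h0 : ∀ y, f y (x 0) = 0 := by
    intro y
    have : f.flip (x 0) = 0 := b.ext fun i => by
      change f (b i) (x 0) = 0
      rw [hleft, hrow]; simp
    exact LinearMap.congr_fun this y
  have hs : ∀ i y, f y (x (i + 1)) = f (x i) y := by
    intro t y
    have : f.flip (x (t + 1)) = f (x t) := b.ext fun i => by
      change f (b i) (x (t + 1)) = _
      rw [hleft, hrow, coeff_X_mul, hright]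
    exact LinearMap.congr_fun this y
  have hne : ∃ t, x t ≠ 0 := by
    by_contra! hcon
    refine hv0 (funext fun j => Polynomial.ext fun t => ?_)
    have := congrArg (fun w => b.repr w j) (hcon t)
    simpa [x, Finsupp.single_apply] using this
  -- Drop the leading zero coefficients so that the chain starts at a nonzero vector.
  obtain ⟨hne', hmin⟩ := And.intro (Nat.find_spec hne) fun t => Nat.find_min hne (m := t)
  set t₀ := Nat.find hne
  refine ⟨fun i => x (t₀ + i), ⟨?_, fun i y => hs (t₀ + i) y⟩, hne',
    Finset.univ.sup fun j => (v j).natDegree, fun i hi => Finset.sum_eq_zero fun j _ => ?_⟩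
  · intro y
    rcases Nat.eq_zero_or_eq_succ_pred t₀ with h | h
    · simpa [h] using h0 y
    · have := not_not.1 (hmin t₀.pred (by omega))
      change f y (x t₀) = 0
      rw [h, Nat.succ_eq_add_one, hs, this, map_zero, LinearMap.zero_apply]
  · have := Finset.le_sup (f := fun j => (v j).natDegree) (Finset.mem_univ j)
    rw [coeff_eq_zero_of_natDegree_lt (by omega), zero_smul]

theorem equivalent_flip_of_forall_ne_top {F V : Type*} [Field F] [IsAlgClosed F] [AddCommGroup V]
    [Module F V] [FiniteDimensional F V] (f : BilinForm F V)
    (hI : ∀ W : Submodule F V, W ≠ ⊤ → ∀ g : BilinForm F W, g.Equivalent g.flip) :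
    f.Equivalent f.flip := by
  by_cases hreg : ∃ l : F, l * l ≠ 1 ∧ ∀ x, (∀ y, f x y - l * f y x = 0) → x = 0
  · obtain ⟨l, hl, hl'⟩ := hreg
    have hB : ∀ x y, (f - l • f.flip : BilinForm F V) x y = f x y - l * f y x := fun _ _ => rfl
    obtain ⟨g, hg⟩ := equivalent_flip_iff.1
      (equivalent_flip_of_separatingLeft (f := f - l • f.flip) (fun x hx => hl' x hx) hI)
    refine equivalent_flip_iff.2 ⟨g, fun x y => ?_⟩
    have h1 := hg x y
    have h2 := hg y x
    rw [hB, hB] at h1 h2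
    -- The isometry identities at `(x, y)` and `(y, x)` form a linear system of determinant `1 -
    -- l²`, which recovers `f`.
    refine mul_right_cancel₀ (sub_ne_zero.2 hl) ?_
    linear_combination -h1 - l * h2
  · have : Infinite F := IsAlgClosed.instInfinite
    obtain ⟨x, hx, hx0, n, hn⟩ := exists_isNullChain (f := f) fun l hl => by
      by_contra! hcon
      exact hreg ⟨l, hl, fun x hx => by
        by_contra hx0
        obtain ⟨y, hy⟩ := hcon x hx0
        exact hy (hx y)⟩
    exact equivalent_flip_of_isNullChain hI hx hx0 hn

/-- Over an algebraically closed field every bilinear form on a finite-dimensional space is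
equivalent to its transpose. -/
theorem equivalent_flip {F V : Type*} [Field F] [IsAlgClosed F] [AddCommGroup V]
    [Module F V] [FiniteDimensional F V] (f : BilinForm F V) : f.Equivalent f.flip := by
  induction hn : finrank F V using Nat.strong_induction_on generalizing V with
  | _ n ih =>
    subst hn
    exact equivalent_flip_of_forall_ne_top f fun W hW g =>
      ih _ (Submodule.finrank_lt hW) g rfl

end Main

end LinearMap.BilinForm

/-- Over an algebraically closed field every square matrix is congruent to its transpose. -/
theorem Matrix.isCongruentTo_transpose {F : Type*} [Field F] [IsAlgClosed F] {n : ℕ}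
    (A : Matrix (Fin n) (Fin n) F) : A.IsCongruentTo A.transpose := by
  obtain ⟨g, hg⟩ := LinearMap.BilinForm.equivalent_flip_iff.1
    (LinearMap.BilinForm.equivalent_flip (Matrix.toBilin' A))
  refine ⟨⟨LinearMap.toMatrix' g, LinearMap.toMatrix' g.symm, ?_, ?_⟩, ?_⟩
  · rw [← LinearMap.toMatrix'_comp]; simp
  · rw [← LinearMap.toMatrix'_comp]; simp
  · apply Matrix.toBilin'.injective
    change _ = Matrix.toBilin' ((LinearMap.toMatrix' g.toLinearMap).transpose * A *
      LinearMap.toMatrix' g.toLinearMap)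
    rw [← Matrix.toBilin'_comp, Matrix.toLin'_toMatrix']
    refine LinearMap.ext fun x => LinearMap.ext fun y => ?_
    change _ = Matrix.toBilin' A (g x) (g y)
    rw [hg, Matrix.toBilin'_apply', Matrix.toBilin'_apply', Matrix.mulVec_transpose,
      dotProduct_comm, ← Matrix.dotProduct_mulVec]

theorem mainTheorem9 {F : Type*} [Field F] [IsAlgClosed F] :
    (∀ (n : ℕ) (A : Matrix (Fin n) (Fin n) F), A.IsCongruentTo A.transpose) ∧
    (∀ (V : Type*) [AddCommGroup V] [Module F V] [FiniteDimensional F V]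
      (f : LinearMap.BilinForm F V), f.Equivalent f.flip) :=
  ⟨fun _ A => A.isCongruentTo_transpose, fun _ _ _ _ f => f.equivalent_flip⟩
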